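/- **Setting.** Let $N\cong\mathbb{Z}^n$ and $M$ be dual lattices with pairing $\langle\cdot,\cdot\rangle$, let $\sigma\subset N_{\mathbb R}$ be a strongly convex rational polyhedral cone with dual cone $\sigma^\vee\subset M_{\mathbb R}$, let $k$ be a field and $R=k[\sigma^\vee\cap M]$. Let $\sigma(1)$ be the set of rays of $\sigma$, $u_\rho\in N$ the primitive generator of $\rho\in\sigma(1)$ and $D_\rho$ the corresponding torus-invariant divisor. *Conic modules.* For $v\in M_{\mathbb R}$ let $A_v=\operatorname{Span}_k\{x^m: m\in M\cap(\sigma^\vee+v)\}$ and $\mathring A_v=\operatorname{Span}_k\{x^m: m\in M\cap(\operatorname{int}(\sigma^\vee)+v)\}$, as $R$-submodules of $k[M]$. The chamber of constancy of $v$ is $\Delta_v=\{w\in M_{\mathbb R}: A_w=A_v\}$. Two points $x,y\in M_{\mathbb R}$ lie in the same open cell iff $A_x=A_y$ and $\mathring A_x=\mathring A_y$; for an open cell $\tau$ write $\mathring A_\tau=\mathring A_x$ for any $x\in\tau$. The complex $K_v^\bullet$ has in degree $l$ the term $\bigoplus_\tau\mathring A_\tau$, over the open cells $\tau\subset\Delta_v$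 of codimension $l$. The isomorphism class of $A_w$ *appears in $K_v^\bullet$ in degree $l$* if $A_w$ is isomorphic as an $R$-module to one of the summands $\mathring A_\tau$ of the term of degree $l$; it *appears in $K_v^\bullet$* if it does so in some degree. *Divisors and paths.* Let $f_\sigma:\bigoplus_{\rho\in\sigma(1)}\mathbb R D_\rho\to \mathrm{Cl}_{\mathbb R}$ be the cokernel of $M_{\mathbb R}\to\bigoplus_\rho\mathbb R D_\rho$, $x\mapsto\sum_\rho\langle x,u_\rho\rangle D_\rho$, and let $\beta_\rho=f_\sigma(D_\rho)$. For integral divisors, $D\sim E$ means $D-E=\sum_\rho\langle m,u_\rho\rangle D_\rho$ for some $m\in M$. For $v\in M_{\mathbb R}$ put $-d(v)=\sum_\rho\lfloor\langle -v,u_\rho\rangle\rfloor D_\rho$. Let $Z$ be the half-open zonotope $f_\sigma((-1,0]^{\sigma(1)})$; its lattice points are the elements of $Z\cap f_\sigma(\mathbb Z^{\sigma(1)})$. For lattice points $P_1,P_2$ of $Z$, a *path* $\beta_J$ from $P_1$ to $P_2$ is given by a subset $J\subset\sigma(1)$ with $P_1+\sum_{\rho\in J}\beta_\rho=P_2$;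 its *length* is $\operatorname{rk}(A_J)$, where $A_J$ is the matrix with rows $u_\rho$, $\rho\in J$. Writing $P_2=\sum_{\rho\in\sigma(1)}\alpha_\rho\beta_\rho$ with $\alpha_\rho\in\mathbb Q$, the path is *valid* if $$\sum_{\rho\in J}\alpha_\rho\beta_\rho\in\sum_{\rho\notin J}\{\gamma\beta_\rho:\gamma\in(-\alpha_\rho-1,-\alpha_\rho)\},$$ where the right-hand side is a Minkowski sum, equal to $\{0\}$ if $J=\sigma(1)$. (This does not depend on the choice of the $\alpha_\rho$.) **Proposition.** Let $v\in M_{\mathbb R}$. 1. For every $P_1\in\mathrm{Cl}_{\mathbb R}$: $P_1$ is a lattice point of $Z$ from which there is a valid path to $f_\sigma(-d(v))$ if and only if there is a $w\in M_{\mathbb R}$ such that the isomorphism class of $A_w$ appears in $K_v^\bullet$ and $P_1=f_\sigma(-d(w))$. 2. Let $\beta_J$ be a valid path from $P_1$ to $f_\sigma(-d(v))$. Then there is a $w\in M_{\mathbb R}$ with $-d(w)\sim-d(v)-\sum_{\rho\in J}D_\rho$, and for every such $w$ one has $P_1=f_\sigma(-d(w))$, and the isomorphism class of $A_w$ appears in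 $K_v^\bullet$ in degree equal to the length $\operatorname{rk}(A_J)$ of $\beta_J$. 3. Conversely, if the isomorphism class of $A_w$ appears in $K_v^\bullet$ in degree $l$, then there is a valid path $\beta_J$ of length $l$ from $f_\sigma(-d(w))$ to $f_\sigma(-d(v))$ with $-d(w)\sim-d(v)-\sum_{\rho\in J}D_\rho$. -/

import Mathlib

open scoped Pointwise DirectSum

/-- A strongly convex rational polyhedral cone `σ` in `N_ℝ = ℝⁿ`, for the lattice `N = ℤⁿ`.
The dual lattice is `M = ℤⁿ`, paired with `N` by the dot product. -/
structure ToricCone (n : ℕ) where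
  toPointedCone : PointedCone ℝ (Fin n → ℝ)
  rational : ∃ S : Finset (Fin n → ℤ),
    toPointedCone = PointedCone.hull ℝ ((fun (u : Fin n → ℤ) (i : Fin n) => (u i : ℝ)) '' ↑S)
  salient : (toPointedCone : ConvexCone ℝ (Fin n → ℝ)).Salient

namespace ToricCone

/-- The inclusion of the lattice `ℤⁿ` in `ℝⁿ`. -/
def toReal {n : ℕ} (m : Fin n → ℤ) : Fin n → ℝ := fun i => (m i : ℝ)

/-- A primitive lattice vector (in particular it is nonzero). -/
def IsPrimitive {n : ℕ} (u : Fin n → ℤ) : Prop :=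
  ∀ (d : ℤ) (w : Fin n → ℤ), u = d • w → IsUnit d

/-- Two primitive vectors on the same ray are equal. -/
theorem IsPrimitive.eq_of_smul {n : ℕ} {u w : Fin n → ℤ} (hu : IsPrimitive u)
    (hw : IsPrimitive w) {r : ℝ} (hr : 0 < r) (h : toReal w = r • toReal u) : w = u := by
  have hb : ∃ c : Fin n → ℤ, ∑ i, c i * u i = 1 := by
    obtain ⟨d, hd⟩ := (inferInstance : (Ideal.span (Set.range u)).IsPrincipal)
    have hdvd : ∀ i, d ∣ u i := fun i => by
      rw [← Ideal.mem_span_singleton]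
      have : u i ∈ Ideal.span (Set.range u) := Ideal.subset_span ⟨i, rfl⟩
      rw [hd] at this
      exact this
    choose c hc using hdvd
    have hunit : IsUnit d := hu d c (by ext i; simp [hc i])
    have h1 : (1 : ℤ) ∈ Ideal.span (Set.range u) := by
      have : Ideal.span (Set.range u) = ⊤ := by
        rw [hd]
        exact Ideal.span_singleton_eq_top.2 hunit
      rw [this]
      trivial
    rw [Ideal.mem_span_range_iff_exists_fun] at h1
    exact h1
  obtain ⟨c, hc⟩ := hb
  have hi : ∀ i, (w i : ℝ) = r * u i := fun i => congrFun h i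
  have hrz : r = ((∑ i, c i * w i : ℤ) : ℝ) := by
    have h2 : ((∑ i, c i * u i : ℤ) : ℝ) = 1 := by exact_mod_cast hc
    push_cast at h2 ⊢
    simp only [hi]
    calc r = r * ∑ i, (c i : ℝ) * u i := by rw [h2, mul_one]
      _ = ∑ i, (c i : ℝ) * (r * u i) := by
        rw [Finset.mul_sum]
        exact Finset.sum_congr rfl fun i _ => by ring
  obtain ⟨z, hz⟩ : ∃ z : ℤ, r = z := ⟨_, hrz⟩
  have hwz : w = z • u := by
    ext i
    have := hi i
    rw [hz] at this
    simpa using (by exact_mod_cast this : w i = z * u i)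
  have hzu := hw z u hwz
  have hz0 : 0 < z := by
    rw [hz] at hr
    exact_mod_cast hr
  have : z = 1 := by
    rcases Int.isUnit_iff.1 hzu with h | h <;> omega
  rw [hwz, this, one_smul]

variable {n : ℕ} (σ : ToricCone n)

/-- The set `σ(1)` of rays (one-dimensional faces) of `σ`, each ray `ρ` being recorded by its
primitive generator `u_ρ ∈ N`. -/
def rays : Set (Fin n → ℤ) :=
  {u | IsPrimitive u ∧ (PointedCone.hull ℝ {toReal u}).IsFaceOf σ.toPointedCone}

theorem rays_finite : σ.rays.Finite := by
  obtain ⟨S, hS⟩ := σ.rational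
  have key : ∀ u ∈ σ.rays, ∃ s ∈ S, ∃ t : ℝ, 0 < t ∧ toReal s = t • toReal u := by
    rintro u ⟨hprim, hface⟩
    by_contra! hno
    have hu : toReal u ∈ σ.toPointedCone :=
      hface.le (PointedCone.subset_hull (Set.mem_singleton _))
    have hu0 : toReal u ≠ 0 := by
      intro h0
      have hz : u = (0 : ℤ) • u := by
        ext i
        have := congrFun h0 i
        simpa [toReal] using this
      simpa using hprim 0 u hz
    rw [hS, PointedCone.hull, ← Finset.coe_image, Submodule.mem_span_finset] at hu
    obtain ⟨c, -, hc⟩ := hu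
    refine hu0 ?_
    rw [← hc]
    refine Finset.sum_eq_zero fun y hy => ?_
    obtain ⟨s, hs, rfl⟩ := Finset.mem_image.1 hy
    by_contra hne
    have hmemS : ∀ y ∈ S.image (fun (u : Fin n → ℤ) (i : Fin n) => (u i : ℝ)),
        c y • y ∈ σ.toPointedCone := fun y hy => by
      refine Submodule.smul_mem _ _ ?_
      rw [hS]
      exact PointedCone.subset_hull (by rw [← Finset.coe_image]; exact hy)
    have hsum := Finset.add_sum_erase _ (fun y => c y • y) hy
    have hin := hface.mem_of_add_mem_left (hmemS _ hy)
      (Submodule.sum_mem _ fun y hy' => hmemS y (Finset.mem_of_mem_erase hy'))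
      (by rw [hsum, hc]; exact PointedCone.subset_hull (Set.mem_singleton _))
    rw [PointedCone.hull, Submodule.mem_span_singleton] at hin
    obtain ⟨b, hb⟩ := hin
    have hcne : c (toReal s) ≠ 0 := fun h => hne (by
      change c (toReal s) • toReal s = 0
      rw [h, zero_smul])
    have hcpos : (0 : ℝ) < (c (toReal s) : ℝ) :=
      lt_of_le_of_ne (c (toReal s)).2 fun h => hcne (Subtype.ext h.symm)
    have hbne : b ≠ 0 := fun h => hne (by rw [← hb, h, zero_smul])
    have hbpos : (0 : ℝ) < (b : ℝ) := lt_of_le_of_ne b.2 fun h => hbne (Subtype.ext h.symm)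
    have hb' : (b : ℝ) • toReal u = (c (toReal s) : ℝ) • toReal s := hb
    refine hno s hs ((c (toReal s) : ℝ)⁻¹ * b) (by positivity) ?_
    rw [mul_smul, hb', smul_smul, inv_mul_cancel₀ hcpos.ne', one_smul]
  choose! g hgS hg using key
  refine Set.Finite.of_finite_image (f := g) (S.finite_toSet.subset ?_) ?_
  · rintro _ ⟨u, hu, rfl⟩
    exact hgS u hu
  · intro u hu w hw h
    obtain ⟨t, ht, h1⟩ := hg u hu
    obtain ⟨s, hs, h2⟩ := hg w hw
    change g u = g w at h
    rw [← h, h1] at h2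
    refine hw.1.eq_of_smul hu.1 (r := t⁻¹ * s) (by positivity) ?_
    rw [mul_smul, ← h2, smul_smul, inv_mul_cancel₀ ht.ne', one_smul]

noncomputable instance : Fintype σ.rays := σ.rays_finite.fintype

/-! ### Conic modules -/

/-- The dual cone `σ^∨ ⊆ M_ℝ`. -/
noncomputable def dualCone : PointedCone ℝ (Fin n → ℝ) :=
  PointedCone.dual (dotProductBilin ℝ ℝ) (σ.toPointedCone : Set (Fin n → ℝ))

/-- The toric algebra `R = k[σ^∨ ∩ M]`, as a subalgebra of `k[M]`. -/
noncomputable def toricAlgebra (k : Type*) [Field k] :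
    Subalgebra k (AddMonoidAlgebra k (Fin n → ℤ)) where
  carrier := {f | ∀ m : Fin n → ℤ, f.coeff m ≠ 0 → toReal m ∈ σ.dualCone}
  mul_mem' {f g} hf hg m hm := by
    classical
    have hm' := AddMonoidAlgebra.support_coeff_mul_subset _ _ (Finsupp.mem_support_iff.2 hm)
    obtain ⟨a, ha, b, hb, rfl⟩ := Finset.mem_add.1 hm'
    have : toReal (a + b) = toReal a + toReal b := by ext i; simp [toReal]
    rw [this]
    exact Submodule.add_mem _ (hf a (Finsupp.mem_support_iff.1 ha))
      (hg b (Finsupp.mem_support_iff.1 hb))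
  add_mem' {f g} hf hg m hm := by
    by_cases h : f.coeff m = 0
    · exact hg m fun h' => hm (by simp [h, h'])
    · exact hf m h
  algebraMap_mem' r m hm := by
    have : m = 0 := by
      by_contra h
      exact hm (by simp [AddMonoidAlgebra.coe_algebraMap, Ne.symm h])
    subst this
    have h0 : toReal (0 : Fin n → ℤ) = 0 := by ext i; simp [toReal]
    rw [h0]
    exact Submodule.zero_mem _

/-- For a set `T ⊆ M` with `(σ^∨ ∩ M) + T ⊆ T`, the `R`-submodule `Span_k {x^m | m ∈ T}` of
`k[M]`, i.e. the set of Laurent polynomials all of whose monomials have exponent in `T`. -/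
noncomputable def monomialSpan (k : Type*) [Field k] (T : Set (Fin n → ℤ))
    (hT : ∀ s t : Fin n → ℤ, toReal s ∈ σ.dualCone → t ∈ T → s + t ∈ T) :
    Submodule (σ.toricAlgebra k) (AddMonoidAlgebra k (Fin n → ℤ)) where
  carrier := {f | ∀ m : Fin n → ℤ, f.coeff m ≠ 0 → m ∈ T}
  zero_mem' m hm := absurd rfl hm
  add_mem' {f g} hf hg m hm := by
    by_cases h : f.coeff m = 0
    · exact hg m fun h' => hm (by simp [h, h'])
    · exact hf m h
  smul_mem' r f hf m hm := by
    classical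
    have hm' := AddMonoidAlgebra.support_coeff_mul_subset _ _ (Finsupp.mem_support_iff.2 hm)
    obtain ⟨a, ha, b, hb, rfl⟩ := Finset.mem_add.1 hm'
    exact hT a b (r.2 a (Finsupp.mem_support_iff.1 ha)) (hf b (Finsupp.mem_support_iff.1 hb))

/-- The conic module `A_v = Span {x^m | m ∈ M ∩ (σ^∨ + v)}`. -/
noncomputable def conicModule (k : Type*) [Field k] (v : Fin n → ℝ) :
    Submodule (σ.toricAlgebra k) (AddMonoidAlgebra k (Fin n → ℤ)) :=
  σ.monomialSpan k {m | toReal m - v ∈ σ.dualCone} fun s t hs ht => by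
    have : toReal (s + t) - v = toReal s + (toReal t - v) := by
      ext i
      simp [toReal, add_sub_assoc]
    change toReal (s + t) - v ∈ σ.dualCone
    rw [this]
    exact Submodule.add_mem _ hs ht

/-- The open conic module `Å_v = Span {x^m | m ∈ M ∩ (int(σ^∨) + v)}`. -/
noncomputable def openConicModule (k : Type*) [Field k] (v : Fin n → ℝ) :
    Submodule (σ.toricAlgebra k) (AddMonoidAlgebra k (Fin n → ℤ)) :=
  σ.monomialSpan k {m | toReal m - v ∈ interior (σ.dualCone : Set (Fin n → ℝ))}
    fun s t hs ht => by
      have : toReal (s + t) - v = toReal s + (toReal t - v) := by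
        ext i
        simp [toReal, add_sub_assoc]
      change toReal (s + t) - v ∈ interior (σ.dualCone : Set (Fin n → ℝ))
      rw [this]
      refine interior_maximal (s := (σ.dualCone : Set (Fin n → ℝ))) ?_
        (isOpen_interior.add_left (s := ({toReal s} : Set (Fin n → ℝ))))
        (Set.add_mem_add (Set.mem_singleton _) ht)
      rintro _ ⟨a, rfl, b, hb, rfl⟩
      exact Submodule.add_mem _ hs (interior_subset hb)

/-! ### Chambers of constancy and the complexes `K_v` -/

/-- The chamber of constancy `Δ_v`. -/
def chamber (k : Type*) [Field k] (v : Fin n → ℝ) : Set (Fin n → ℝ) :=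
  {w | σ.conicModule k w = σ.conicModule k v}

/-- The open cell containing `x` of the CW decomposition of `M_ℝ`: two points lie in the same
open cell iff their conic modules are equal and their open conic modules are equal. -/
def cell (k : Type*) [Field k] (x : Fin n → ℝ) : Set (Fin n → ℝ) :=
  {y | σ.conicModule k y = σ.conicModule k x ∧ σ.openConicModule k y = σ.openConicModule k x}

/-- The set of open cells of codimension `l` of the chamber of constancy `Δ_v`. -/
def cellsOfCodim (k : Type*) [Field k] (v : Fin n → ℝ) (l : ℕ) : Set (Set (Fin n → ℝ)) :=
  {τ | ∃ x ∈ σ.chamber k v, τ = σ.cell k x ∧ Module.finrank ℝ (vectorSpan ℝ τ) + l = n}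

/-- The open conic module `Å_τ` of an open cell `τ`: the common value of `Å_x` for `x ∈ τ`. -/
noncomputable def cellModule (k : Type*) [Field k] (τ : Set (Fin n → ℝ)) :
    Submodule (σ.toricAlgebra k) (AddMonoidAlgebra k (Fin n → ℤ)) :=
  ⨆ x ∈ τ, σ.openConicModule k x

theorem cellModule_cell (k : Type*) [Field k] (x : Fin n → ℝ) :
    σ.cellModule k (σ.cell k x) = σ.openConicModule k x :=
  le_antisymm (iSup₂_le fun _ hy => hy.2.le)
    (le_iSup₂_of_le (f := fun y (_ : y ∈ σ.cell k x) => σ.openConicModule k y) x ⟨rfl, rfl⟩ le_rfl)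

/-- The term in degree `l` of the complex `K_v`: the direct sum of the `Å_τ` over the open cells
`τ` of codimension `l` of `Δ_v`. -/
abbrev complexTerm (k : Type*) [Field k] (v : Fin n → ℝ) (l : ℕ) : Type _ :=
  ⨁ τ : σ.cellsOfCodim k v l, σ.cellModule k τ.1

/-- The isomorphism class of `A_w` appears in `K_v` in degree `l`: the module `A_w` is isomorphic
to one of the summands `Å_τ` of the degree `l` term of `K_v`. -/
def AppearsInDegree (k : Type*) [Field k] (w v : Fin n → ℝ) (l : ℕ) : Prop :=
  ∃ τ : σ.cellsOfCodim k v l,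
    Nonempty (σ.conicModule k w ≃ₗ[σ.toricAlgebra k] σ.cellModule k τ.1)

/-- The isomorphism class of `A_w` appears in `K_v`. -/
def Appears (k : Type*) [Field k] (w v : Fin n → ℝ) : Prop :=
  ∃ l : ℕ, σ.AppearsInDegree k w v l

/-! ### Divisors, the class group over `ℝ`, and the zonotope -/

/-- `div(x^m) = ∑_ρ ⟨m, u_ρ⟩ D_ρ`. -/
def divisor (m : Fin n → ℤ) : σ.rays → ℤ := fun ρ => m ⬝ᵥ ρ.1

/-- Linear equivalence of torus-invariant Weil divisors `∑_ρ D ρ • D_ρ`. -/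
def LinEquiv (D E : σ.rays → ℤ) : Prop := ∃ m : Fin n → ℤ, D = E + σ.divisor m

/-- The divisor `-d(v) = ∑_ρ ⌊⟨-v, u_ρ⟩⌋ D_ρ`. -/
noncomputable def negD (v : Fin n → ℝ) : σ.rays → ℤ := fun ρ => ⌊(-v) ⬝ᵥ toReal ρ.1⌋

/-- The map `M_ℝ → ⨁_ρ ℝ D_ρ`, `x ↦ ∑_ρ ⟨x, u_ρ⟩ D_ρ`. -/
noncomputable def divisorReal : (Fin n → ℝ) →ₗ[ℝ] (σ.rays → ℝ) :=
  LinearMap.pi fun ρ => (dotProductBilin ℝ ℝ).flip (toReal ρ.1)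

/-- `Cl_ℝ`, the cokernel of `M_ℝ → ⨁_ρ ℝ D_ρ`. -/
abbrev ClReal : Type := (σ.rays → ℝ) ⧸ LinearMap.range σ.divisorReal

/-- The cokernel map `f_σ : ⨁_ρ ℝ D_ρ → Cl_ℝ`. -/
noncomputable def fσ : (σ.rays → ℝ) →ₗ[ℝ] σ.ClReal :=
  (LinearMap.range σ.divisorReal).mkQ

/-- The value of `f_σ` on an integral divisor. -/
noncomputable def fInt (D : σ.rays → ℤ) : σ.ClReal := σ.fσ fun ρ => (D ρ : ℝ)

/-- `β_ρ = f_σ(D_ρ)`. -/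
noncomputable def β (ρ : σ.rays) : σ.ClReal := σ.fσ (Pi.single ρ 1)

/-- The half-open zonotope, the image of `(-1, 0]^σ(1)` under `f_σ`. -/
noncomputable def zonotope : Set σ.ClReal := σ.fσ '' {a | ∀ ρ, a ρ ∈ Set.Ioc (-1 : ℝ) 0}

/-- The lattice points of the zonotope, with respect to the lattice `f_σ(ℤ^σ(1))`. -/
noncomputable def latticePoints : Set σ.ClReal := σ.zonotope ∩ Set.range σ.fInt

/-! ### Paths -/

/-- The subset `J ⊆ σ(1)` gives a path `β_J` from `P₁` to `P₂`. -/
def IsPath (J : Finset σ.rays) (P₁ P₂ : σ.ClReal) : Prop :=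
  P₁ ∈ σ.latticePoints ∧ P₂ ∈ σ.latticePoints ∧ P₁ + ∑ ρ ∈ J, σ.β ρ = P₂

/-- The length `rk(A_J)` of the path `β_J`; `A_J` is the matrix with rows `u_ρ`, `ρ ∈ J`. -/
noncomputable def pathLength (J : Finset σ.rays) : ℕ :=
  (Matrix.of fun (ρ : J) (i : Fin n) => (ρ.1.1 i : ℝ)).rank

/-- The interval `{γ β_ρ | γ ∈ (-α_ρ - 1, -α_ρ)}`. -/
noncomputable def interval (α : σ.rays → ℚ) (ρ : σ.rays) : Set σ.ClReal :=
  (fun γ : ℝ => γ • σ.β ρ) '' Set.Ioo (-(α ρ : ℝ) - 1) (-(α ρ : ℝ))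

/-- The condition `∑_{ρ ∈ J} α_ρ β_ρ ∈ ∑_{ρ ∉ J} {γ β_ρ | γ ∈ (-α_ρ - 1, -α_ρ)}` on `J` and `α`;
the right hand side is a Minkowski sum of sets, which is `{0}` if `J = σ(1)`. -/
def ValidityCondition (J : Finset σ.rays) (α : σ.rays → ℚ) : Prop :=
  ∑ ρ ∈ J, (α ρ : ℝ) • σ.β ρ ∈ ∑ ρ ∈ Jᶜ, σ.interval α ρ

/-- The path `β_J` from `P₁` to `P₂` is valid: the validity condition holds when `P₂` is written
as `∑_ρ α_ρ β_ρ` with rational `α_ρ`. -/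
def IsValidPath (J : Finset σ.rays) (P₁ P₂ : σ.ClReal) : Prop :=
  σ.IsPath J P₁ P₂ ∧
    ∃ α : σ.rays → ℚ, P₂ = ∑ ρ, (α ρ : ℝ) • σ.β ρ ∧ σ.ValidityCondition J α

theorem validityCondition_iff (J : Finset σ.rays) (α : σ.rays → ℚ) :
    σ.ValidityCondition J α ↔ ∃ t : σ.rays → ℝ, (∀ ρ, t ρ ∈ Set.Ioo (0 : ℝ) 1) ∧
      ∑ ρ, (α ρ : ℝ) • σ.β ρ = -∑ ρ ∈ Jᶜ, t ρ • σ.β ρ := by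
  have hsplit := Finset.sum_add_sum_compl J fun ρ => (α ρ : ℝ) • σ.β ρ
  rw [ValidityCondition, Set.mem_finsetSum]
  constructor
  · rintro ⟨g, hg, hsum⟩
    have h : ∀ ρ, ∃ t : ℝ, t ∈ Set.Ioo (0 : ℝ) 1 ∧
        (ρ ∈ Jᶜ → g ρ = (-(α ρ : ℝ) - t) • σ.β ρ) := fun ρ => by
      by_cases hρ : ρ ∈ Jᶜ
      · obtain ⟨γ, hγ, h⟩ := hg hρ
        exact ⟨-(α ρ : ℝ) - γ, ⟨by linarith [hγ.2], by linarith [hγ.1]⟩,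
          fun _ => by rw [← h]; simp⟩
      · exact ⟨1 / 2, by norm_num, fun h => absurd h hρ⟩
    choose t ht hgt using h
    refine ⟨t, ht, ?_⟩
    rw [← hsplit, ← hsum, Finset.sum_congr rfl hgt]
    simp only [sub_smul, neg_smul, Finset.sum_sub_distrib, Finset.sum_neg_distrib]
    abel
  · rintro ⟨t, ht, hsum⟩
    refine ⟨fun ρ => (-(α ρ : ℝ) - t ρ) • σ.β ρ, fun {ρ} _ => ⟨_, ⟨?_, ?_⟩, rfl⟩, ?_⟩
    · linarith [(ht ρ).2]
    · linarith [(ht ρ).1]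
    · rw [← hsplit] at hsum
      simp only [sub_smul, neg_smul, Finset.sum_sub_distrib, Finset.sum_neg_distrib]
      rw [eq_sub_of_add_eq hsum]
      abel

/-- The validity of a path does not depend on the choice of the coefficients `α_ρ`. -/
theorem validityCondition_congr (J : Finset σ.rays) {α α' : σ.rays → ℚ}
    (h : ∑ ρ, (α ρ : ℝ) • σ.β ρ = ∑ ρ, (α' ρ : ℝ) • σ.β ρ) :
    σ.ValidityCondition J α ↔ σ.ValidityCondition J α' := by
  rw [validityCondition_iff, validityCondition_iff, h]

/-- The divisor `∑_{ρ ∈ J} D_ρ`. -/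
def sumD (J : Finset σ.rays) : σ.rays → ℤ := ∑ ρ ∈ J, Pi.single ρ 1

end ToricCone

/-!
An open cell of `Δ_v` amounts to rounding data: a point `x` lies in `Δ_v` iff `⌈⟨x, u_ρ⟩⌉` agrees
with `⌈⟨v, u_ρ⟩⌉` for all `ρ`, i.e. `-d(x) = -d(v)`, and its cell inside `Δ_v` is determined by the
set `J` of rays on which `x` is integral. The cell is open in an affine space with direction
`ker A_J`, so its codimension is `rk A_J`. Both kinds of conic modules are modules of sections of
reflexive sheaves: `A_x` belongs to `-d(x)` and `Å_x` to `-d(x) - ∑_{ρ ∈ J} D_ρ`. Two such modules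
are isomorphic iff their divisors are linearly equivalent: `k[M]` consists of fractions of `R`, so
that an isomorphism is multiplication by a unit of `k[M]`, which is a monomial up to a scalar.
Finally, the validity condition on `J`, once the coefficients of the `β_ρ` are adjusted by the image
of `M_ℝ`, says exactly that `J` is the set of integral rays of some point of `Δ_v`.
-/

section Cones

variable {𝕜 E : Type*} [Field 𝕜] [LinearOrder 𝕜] [IsStrictOrderedRing 𝕜] [AddCommGroup E]
  [Module 𝕜 E]

theorem mem_hull_singleton {x y : E} :
    x ∈ PointedCone.hull 𝕜 {y} ↔ ∃ r : 𝕜, 0 ≤ r ∧ r • y = x :=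
  Submodule.mem_span_singleton.trans
    ⟨fun ⟨r, h⟩ => ⟨r, r.2, h⟩, fun ⟨r, hr, h⟩ => ⟨⟨r, hr⟩, h⟩⟩

theorem hull_singleton_smul {r : 𝕜} (hr : 0 < r) (x : E) :
    PointedCone.hull 𝕜 {r • x} = PointedCone.hull 𝕜 {x} := by
  refine le_antisymm ?_ ?_ <;> rw [Submodule.span_singleton_le_iff_mem, mem_hull_singleton]
  · exact ⟨r, hr.le, rfl⟩
  · exact ⟨r⁻¹, inv_nonneg.2 hr.le, inv_smul_smul₀ hr.ne' x⟩

theorem isFaceOf_hull_singleton_sup {s : E} {T : PointedCone 𝕜 E}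
    (hsal : (PointedCone.hull 𝕜 {s} ⊔ T).toConvexCone.Salient) (hs : s ∉ T) :
    (PointedCone.hull 𝕜 {s}).IsFaceOf (PointedCone.hull 𝕜 {s} ⊔ T) := by
  refine .of_mem_of_add_mem_left le_sup_left fun {x y} hx hy hxy => ?_
  obtain ⟨_, hx', p, hp, rfl⟩ := Submodule.mem_sup.1 hx
  obtain ⟨_, hy', q, hq, rfl⟩ := Submodule.mem_sup.1 hy
  obtain ⟨c, -, rfl⟩ := mem_hull_singleton.1 hx'
  obtain ⟨d, -, rfl⟩ := mem_hull_singleton.1 hy'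
  obtain ⟨b, -, hb⟩ := mem_hull_singleton.1 hxy
  rcases lt_or_ge (c + d) b with hlt | hle
  · have hT : (b - (c + d)) • s ∈ T := by
      convert add_mem hp hq using 1
      rw [sub_smul, hb]
      module
    exact absurd ((PointedCone.smul_mem_iff _ (sub_pos.2 hlt)).1 hT) hs
  · have hneg : -p ∈ PointedCone.hull 𝕜 {s} ⊔ T := by
      refine Submodule.mem_sup.2
        ⟨_, mem_hull_singleton.2 ⟨_, sub_nonneg.2 hle, rfl⟩, q, hq, ?_⟩
      rw [sub_smul, hb]
      module
    have hp0 : p = 0 := by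
      by_contra hne
      exact hsal p (Submodule.mem_sup_right hp) hne hneg
    rwa [hp0, add_zero]

theorem hull_setOf_isFaceOf_hull_singleton {S : Set E} (hS : S.Finite)
    (hsal : (PointedCone.hull 𝕜 S).toConvexCone.Salient) :
    PointedCone.hull 𝕜 {s ∈ S | (PointedCone.hull 𝕜 {s}).IsFaceOf (PointedCone.hull 𝕜 S)} =
      PointedCone.hull 𝕜 S := by
  obtain ⟨T, ⟨hTS, hT⟩, hmin⟩ := (hS.finite_subsets.subset fun _ h => h.1).exists_minimal
    (⟨S, subset_rfl, rfl⟩ : {T | T ⊆ S ∧ PointedCone.hull 𝕜 T = PointedCone.hull 𝕜 S}.Nonempty)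
  refine le_antisymm (Submodule.span_mono fun _ h => h.1) ?_
  rw [← hT]
  refine Submodule.span_mono fun s hs => ⟨hTS hs, ?_⟩
  have hsup : PointedCone.hull 𝕜 T = PointedCone.hull 𝕜 {s} ⊔ PointedCone.hull 𝕜 (T \ {s}) := by
    rw [← Submodule.span_insert, Set.insert_sdiff_singleton, Set.insert_eq_of_mem hs]
  rw [hsup]
  refine isFaceOf_hull_singleton_sup (by rwa [← hsup, hT]) fun hmem => ?_
  have hdrop : PointedCone.hull 𝕜 (T \ {s}) = PointedCone.hull 𝕜 S := by
    rw [← hT, hsup, right_eq_sup, Submodule.span_singleton_le_iff_mem]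
    exact hmem
  exact (hmin ⟨Set.sdiff_subset.trans hTS, hdrop⟩ Set.sdiff_subset hs).2 rfl

theorem mem_of_mem_span_of_isFaceOf {F C : PointedCone 𝕜 E} (hF : F.IsFaceOf C) {x : E}
    (hxC : x ∈ C) (hx : x ∈ Submodule.span 𝕜 (F : Set E)) : x ∈ F := by
  suffices ∃ y ∈ F, x + y ∈ F by
    obtain ⟨y, hy, hxy⟩ := this
    exact hF.mem_of_add_mem_left hxC (hF.le hy) hxy
  clear hxC
  induction hx using Submodule.span_induction with
  | mem x h => exact ⟨0, zero_mem F, by rwa [add_zero]⟩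
  | zero => exact ⟨0, zero_mem F, by rw [add_zero]; exact zero_mem F⟩
  | add x x' _ _ ih ih' =>
    obtain ⟨y, hy, hxy⟩ := ih
    obtain ⟨y', hy', hxy'⟩ := ih'
    exact ⟨y + y', add_mem hy hy', by rw [add_add_add_comm]; exact add_mem hxy hxy'⟩
  | smul r x _ ih =>
    obtain ⟨y, hy, hxy⟩ := ih
    rcases le_total 0 r with hr | hr
    · exact ⟨r • y, F.smul_mem hr hy, by rw [← smul_add]; exact F.smul_mem hr hxy⟩
    · refine ⟨-r • (x + y), F.smul_mem (neg_nonneg.2 hr) hxy, ?_⟩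
      convert F.smul_mem (neg_nonneg.2 hr) hy using 1
      module

end Cones

theorem eq_zero_of_forall_mem_lt {𝕜 E : Type*} [Field 𝕜] [Preorder 𝕜] [AddCommGroup E]
    [Module 𝕜 E] {V : Submodule 𝕜 E} {f : E →ₗ[𝕜] 𝕜} {b : 𝕜} (h : ∀ x ∈ V, f x < b) {x : E}
    (hx : x ∈ V) : f x = 0 := by
  by_contra hne
  have := h ((b / f x) • x) (V.smul_mem _ hx)
  rw [map_smul, smul_eq_mul, div_mul_cancel₀ _ hne] at this
  exact this.false

theorem exists_eq_zero_and_pos_of_isFaceOf {E : Type*} [NormedAddCommGroup E]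
    [NormedSpace ℝ E] [FiniteDimensional ℝ E] {F C : PointedCone ℝ E} (hF : F.IsFaceOf C)
    {S : Set E} (hS : S.Finite) (hSC : S ⊆ C \ F) :
    ∃ f : StrongDual ℝ E, (∀ x ∈ F, f x = 0) ∧ ∀ x ∈ S, 0 < f x := by
  let V := Submodule.span ℝ (F : Set E)
  have hdisj : Disjoint (V : Set E) (convexHull ℝ S) := by
    rw [Set.disjoint_right]
    intro x hx hxV
    have hxC := convexHull_min hSC (hF.isExtreme.convex_sdiff C.convex) hx
    exact hxC.2 (mem_of_mem_span_of_isFaceOf hF hxC.1 hxV)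
  obtain ⟨f, a, b, ha, hab, hb⟩ := geometric_hahn_banach_closed_compact V.convex
    V.closed_of_finiteDimensional (convex_convexHull ℝ S) (hS.isCompact_convexHull ℝ) hdisj
  have ha0 : 0 < a := by simpa using ha 0 V.zero_mem
  exact ⟨f, fun x hx => eq_zero_of_forall_mem_lt (f := f.toLinearMap) ha (Submodule.subset_span hx),
    fun x hx => (ha0.trans hab).trans (hb x (subset_convexHull ℝ S hx))⟩

section Topology

variable {E : Type*} [AddCommGroup E] [Module ℝ E] [TopologicalSpace E] [ContinuousAdd E]
  [ContinuousSMul ℝ E]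

theorem mem_interior_setOf_forall_nonneg_iff {ι : Type*} [Finite ι] {f : ι → StrongDual ℝ E}
    (hf : ∀ i, f i ≠ 0) {x : E} : x ∈ interior {x | ∀ i, 0 ≤ f i x} ↔ ∀ i, 0 < f i x := by
  have : {x | ∀ i, 0 ≤ f i x} = ⋂ i, f i ⁻¹' Set.Ici 0 := by ext; simp
  rw [this, interior_iInter_of_finite]
  simp [← ((f _).isOpenMap_of_ne_zero (hf _)).preimage_interior_eq_interior_preimage
    (f _).continuous]

theorem vectorSpan_inter_of_isOpen {A : AffineSubspace ℝ E} {U : Set E} (hU : IsOpen U)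
    (h : ((A : Set E) ∩ U).Nonempty) : vectorSpan ℝ ((A : Set E) ∩ U) = A.direction := by
  obtain ⟨x, hxA, hxU⟩ := h
  refine le_antisymm (vectorSpan_mono ℝ Set.inter_subset_left) fun w hw => ?_
  have hev : ∀ᶠ ε : ℝ in nhdsWithin 0 (Set.Ioi 0), x + ε • w ∈ U := by
    have hcont : Continuous fun ε : ℝ => x + ε • w := by fun_prop
    exact ((hcont.tendsto 0).eventually (hU.mem_nhds (by simpa using hxU))).filter_mono
      nhdsWithin_le_nhds
  obtain ⟨ε, hεU, hε⟩ := (hev.and self_mem_nhdsWithin).exists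
  have hεA : x + ε • w ∈ A := by
    rw [add_comm]
    exact AffineSubspace.vadd_mem_of_mem_direction (A.direction.smul_mem ε hw) hxA
  have hsub := vsub_mem_vectorSpan ℝ (s := (A : Set E) ∩ U) ⟨hεA, hεU⟩ ⟨hxA, hxU⟩
  rw [vsub_eq_sub, add_sub_cancel_left] at hsub
  exact (Submodule.smul_mem_iff _ (Set.mem_Ioi.1 hε).ne').1 hsub

end Topology

namespace ToricCone

section Lattice

variable {n : ℕ}

theorem toReal_zero : toReal (0 : Fin n → ℤ) = 0 := by
  ext i
  simp [toReal]

theorem toReal_injective : Function.Injective (toReal (n := n)) := fun _ _ h =>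
  funext fun i => Int.cast_injective (congrFun h i)

theorem toReal_dotProduct (a b : Fin n → ℤ) : toReal a ⬝ᵥ toReal b = ((a ⬝ᵥ b : ℤ) : ℝ) := by
  simp [toReal, dotProduct]

theorem IsPrimitive.ne_zero {u : Fin n → ℤ} (hu : IsPrimitive u) : u ≠ 0 := by
  rintro rfl
  simpa using hu 0 0 (by simp)

theorem IsPrimitive.toReal_ne_zero {u : Fin n → ℤ} (hu : IsPrimitive u) : toReal u ≠ 0 := by
  rw [← toReal_zero]
  exact toReal_injective.ne hu.ne_zero

theorem exists_isPrimitive {s : Fin n → ℤ} (hs : s ≠ 0) :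
    ∃ u, IsPrimitive u ∧ ∃ r : ℝ, 0 < r ∧ toReal s = r • toReal u := by
  obtain ⟨i, hi⟩ := Function.ne_iff.1 hs
  obtain ⟨u, hu, hu1⟩ := Finset.extract_gcd s ⟨i, Finset.mem_univ i⟩
  have hgcd : 0 < Finset.univ.gcd s :=
    (Int.nonneg_of_normalize_eq_self Finset.normalize_gcd).lt_of_ne' fun h =>
      hi (Finset.gcd_eq_zero_iff.1 h i (Finset.mem_univ i))
  refine ⟨u, fun d w hw => ?_, (Finset.univ.gcd s : ℤ), by exact_mod_cast hgcd, ?_⟩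
  · rw [isUnit_iff_dvd_one, ← hu1]
    exact Finset.dvd_gcd fun j _ => ⟨w j, by simp [hw]⟩
  · ext j
    simp only [toReal, Pi.smul_apply, smul_eq_mul]
    exact_mod_cast hu j (Finset.mem_univ j)

theorem IsPrimitive.exists_dotProduct_eq_one {u : Fin n → ℤ} (hu : IsPrimitive u) :
    ∃ c : Fin n → ℤ, c ⬝ᵥ u = 1 := by
  obtain ⟨w, hw⟩ : ∃ w, u = Finset.univ.gcd u • w :=
    ⟨fun i => u i / Finset.univ.gcd u, funext fun i =>
      (Int.mul_ediv_cancel' (Finset.gcd_dvd (Finset.mem_univ i))).symm⟩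
  have hgcd : Finset.univ.gcd u = 1 := by
    rw [← Finset.normalize_gcd, normalize_eq_one]
    exact hu _ w hw
  obtain ⟨c, hc⟩ := Finset.gcd_eq_sum_mul .univ u
  exact ⟨c, by rw [dotProduct_comm, ← hgcd, hc]; rfl⟩

theorem exists_toReal_mem_of_isOpen {U : Set (Fin n → ℝ)} (hU : IsOpen U) (hne : U.Nonempty)
    (hsmul : ∀ N : ℕ, 0 < N → ∀ x ∈ U, (N : ℝ) • x ∈ U) : ∃ m : Fin n → ℤ, toReal m ∈ U := by
  have hdense : DenseRange (Pi.map fun (_ : Fin n) (q : ℚ) => (q : ℝ)) :=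
    DenseRange.piMap fun _ => Rat.denseRange_cast
  obtain ⟨q, hq⟩ := hdense.exists_mem_open hU hne
  have hint : ∀ i, ∃ z : ℤ, (z : ℝ) = (∏ j, (q j).den : ℕ) * (q i : ℝ) := fun i => by
    obtain ⟨d, hd⟩ := Finset.dvd_prod_of_mem (fun j => (q j).den) (Finset.mem_univ i)
    refine ⟨d * (q i).num, ?_⟩
    have hnum : ((q i).den : ℝ) * (q i : ℝ) = (q i).num := by exact_mod_cast Rat.den_mul_eq_num _
    rw [hd]
    push_cast
    rw [← hnum]
    ring
  choose m hm using hint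
  refine ⟨m, ?_⟩
  convert hsmul _ (Finset.prod_pos fun j _ => (q j).den_pos) _ hq using 1
  exact funext hm

end Lattice

section Rays

variable {n : ℕ} (σ : ToricCone n)

theorem toReal_mem_of_mem_rays {u : Fin n → ℤ} (hu : u ∈ σ.rays) : toReal u ∈ σ.toPointedCone :=
  hu.2.le (PointedCone.subset_hull rfl)

theorem hull_rays : PointedCone.hull ℝ (toReal '' σ.rays) = σ.toPointedCone := by
  refine le_antisymm (Submodule.span_le.2 (Set.image_subset_iff.2 fun u =>
    σ.toReal_mem_of_mem_rays)) ?_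
  obtain ⟨S, hS⟩ := σ.rational
  have hsal := σ.salient
  rw [hS] at hsal
  rw [hS, ← hull_setOf_isFaceOf_hull_singleton (S.finite_toSet.image _) hsal, ← hS]
  refine Submodule.span_le.2 ?_
  rintro _ ⟨⟨s, -, rfl⟩, hface⟩
  change toReal s ∈ PointedCone.hull ℝ (toReal '' σ.rays)
  change (PointedCone.hull ℝ {toReal s}).IsFaceOf _ at hface
  obtain rfl | hs := eq_or_ne s 0
  · rw [toReal_zero]
    exact zero_mem _
  obtain ⟨u, hu, r, hr, hsu⟩ := exists_isPrimitive hs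
  rw [hsu] at hface ⊢
  rw [hull_singleton_smul hr] at hface
  exact PointedCone.smul_mem _ hr.le (PointedCone.subset_hull ⟨u, ⟨hu, hface⟩, rfl⟩)

theorem mem_dualCone {y : Fin n → ℝ} :
    y ∈ σ.dualCone ↔ ∀ ρ : σ.rays, 0 ≤ y ⬝ᵥ toReal ρ.1 := by
  rw [dualCone, ← σ.hull_rays, PointedCone.dual_hull, PointedCone.mem_dual]
  simp [dotProduct_comm]

theorem mem_interior_dualCone {y : Fin n → ℝ} :
    y ∈ interior (σ.dualCone : Set (Fin n → ℝ)) ↔ ∀ ρ : σ.rays, 0 < y ⬝ᵥ toReal ρ.1 := by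
  let f (ρ : σ.rays) : StrongDual ℝ (Fin n → ℝ) :=
    (dotProductBilin ℝ ℝ (toReal ρ.1)).toContinuousLinearMap
  have hf : ∀ ρ y, f ρ y = y ⬝ᵥ toReal ρ.1 := fun ρ y => dotProduct_comm (toReal ρ.1) y
  have hf0 : ∀ ρ, f ρ ≠ 0 := fun ρ h => ρ.2.1.toReal_ne_zero <| by
    rw [← dotProduct_self_eq_zero, ← hf, h, zero_apply]
  have hdual : (σ.dualCone : Set (Fin n → ℝ)) = {y | ∀ ρ, 0 ≤ f ρ y} :=
    Set.ext fun y => by simp only [SetLike.mem_coe, mem_dualCone, hf, Set.mem_ofPred_eq]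
  rw [hdual, mem_interior_setOf_forall_nonneg_iff hf0]
  simp only [hf]

theorem toReal_notMem_hull_of_ne {ρ τ : σ.rays} (h : τ ≠ ρ) :
    toReal τ.1 ∉ PointedCone.hull ℝ {toReal ρ.1} := fun hmem => by
  obtain ⟨r, hr, hrτ⟩ := mem_hull_singleton.1 hmem
  have hr0 : r ≠ 0 := by
    rintro rfl
    exact τ.2.1.toReal_ne_zero (by rw [← hrτ, zero_smul])
  exact h (Subtype.ext (ρ.2.1.eq_of_smul τ.2.1 (hr.lt_of_ne' hr0) hrτ.symm))

theorem exists_dotProduct_eq_zero_and_pos (ρ : σ.rays) : ∃ y : Fin n → ℝ,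
    y ⬝ᵥ toReal ρ.1 = 0 ∧ ∀ τ : σ.rays, τ ≠ ρ → 0 < y ⬝ᵥ toReal τ.1 := by
  have hsub : (fun τ : σ.rays => toReal τ.1) '' {ρ}ᶜ ⊆
      (σ.toPointedCone : Set (Fin n → ℝ)) \ PointedCone.hull ℝ {toReal ρ.1} := by
    rintro _ ⟨τ, hτ, rfl⟩
    exact ⟨σ.toReal_mem_of_mem_rays τ.2, σ.toReal_notMem_hull_of_ne hτ⟩
  obtain ⟨f, hfρ, hf⟩ := exists_eq_zero_and_pos_of_isFaceOf ρ.2.2 (Set.toFinite _) hsub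
  obtain ⟨y, hy⟩ := (dotProductEquiv ℝ (Fin n)).surjective f.toLinearMap
  have hyf : ∀ x, y ⬝ᵥ x = f x := fun x => DFunLike.congr_fun hy x
  refine ⟨y, ?_, fun τ hτ => ?_⟩ <;> rw [hyf]
  · exact hfρ _ (PointedCone.subset_hull rfl)
  · exact hf _ ⟨τ, hτ, rfl⟩

end Rays

section Divisors

variable {n : ℕ} (σ : ToricCone n)

theorem divisor_add (a b : Fin n → ℤ) : σ.divisor (a + b) = σ.divisor a + σ.divisor b :=
  funext fun ρ => add_dotProduct a b ρ.1

theorem divisor_smul (z : ℤ) (a : Fin n → ℤ) : σ.divisor (z • a) = z • σ.divisor a :=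
  funext fun ρ => smul_dotProduct z a ρ.1

theorem divisor_sub (a b : Fin n → ℤ) : σ.divisor (a - b) = σ.divisor a - σ.divisor b :=
  funext fun ρ => sub_dotProduct a b ρ.1

theorem exists_divisor_eq_one (ρ : σ.rays) : ∃ m : Fin n → ℤ, σ.divisor m ρ = 1 :=
  ρ.2.1.exists_dotProduct_eq_one

theorem exists_divisor_eq_zero_and_pos (ρ : σ.rays) :
    ∃ m : Fin n → ℤ, σ.divisor m ρ = 0 ∧ ∀ τ, τ ≠ ρ → 0 < σ.divisor m τ := by
  obtain ⟨y, hyρ, hy⟩ := σ.exists_dotProduct_eq_zero_and_pos ρ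
  obtain ⟨p, hp⟩ := σ.exists_divisor_eq_one ρ
  let U : Set (Fin n → ℝ) := {x | ∀ τ : σ.rays, τ ≠ ρ →
    0 < x ⬝ᵥ toReal τ.1 - (x ⬝ᵥ toReal ρ.1) * (toReal p ⬝ᵥ toReal τ.1)}
  have hU : IsOpen U := by
    simp only [U, Set.ofPred_forall]
    refine isOpen_iInter_of_finite fun τ => isOpen_iInter_of_finite fun _ =>
      isOpen_lt continuous_const ?_
    unfold dotProduct
    fun_prop
  have hsmul : ∀ N : ℕ, 0 < N → ∀ x ∈ U, (N : ℝ) • x ∈ U := fun N hN x hx τ hτ => by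
    rw [smul_dotProduct, smul_dotProduct, smul_eq_mul, smul_eq_mul, mul_assoc, ← mul_sub]
    exact mul_pos (Nat.cast_pos.2 hN) (hx τ hτ)
  obtain ⟨m, hm⟩ := exists_toReal_mem_of_isOpen hU
    ⟨y, fun τ hτ => by rw [hyρ, zero_mul, sub_zero]; exact hy τ hτ⟩ hsmul
  refine ⟨m - σ.divisor m ρ • p, ?_, fun τ hτ => ?_⟩ <;>
    rw [divisor_sub, divisor_smul, Pi.sub_apply, Pi.smul_apply, smul_eq_mul]
  · rw [hp, mul_one, sub_self]
  · have := hm τ hτ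
    simp only [toReal_dotProduct] at this
    exact_mod_cast this

theorem exists_divisor_eq_and_le (c : σ.rays → ℤ) (ρ : σ.rays) :
    ∃ m : Fin n → ℤ, σ.divisor m ρ = c ρ ∧ c ≤ σ.divisor m := by
  obtain ⟨p, hp⟩ := σ.exists_divisor_eq_one ρ
  obtain ⟨q, hqρ, hq⟩ := σ.exists_divisor_eq_zero_and_pos ρ
  let d : σ.rays → ℤ := c - c ρ • σ.divisor p
  let N : ℤ := ∑ τ, |d τ|
  have hdiv : ∀ τ, σ.divisor (c ρ • p + N • q) τ = c ρ * σ.divisor p τ + N * σ.divisor q τ :=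
    fun τ => by
    simp only [divisor_add, divisor_smul, Pi.add_apply, Pi.smul_apply, smul_eq_mul]
  have hρ : σ.divisor (c ρ • p + N • q) ρ = c ρ := by
    rw [hdiv, hp, hqρ, mul_one, mul_zero, add_zero]
  refine ⟨c ρ • p + N • q, hρ, fun τ => ?_⟩
  obtain rfl | hτ := eq_or_ne τ ρ
  · exact hρ.ge
  rw [hdiv, ← sub_le_iff_le_add']
  calc d τ ≤ |d τ| := le_abs_self _
    _ ≤ N := Finset.single_le_sum (fun τ _ => abs_nonneg (d τ)) (Finset.mem_univ τ)
    _ ≤ N * σ.divisor q τ :=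
      le_mul_of_one_le_right (Finset.sum_nonneg fun τ _ => abs_nonneg (d τ)) (hq τ hτ)

theorem exists_le_divisor (c : σ.rays → ℤ) : ∃ m : Fin n → ℤ, c ≤ σ.divisor m := by
  obtain _ | ⟨⟨ρ⟩⟩ := isEmpty_or_nonempty σ.rays
  · exact ⟨0, fun ρ => isEmptyElim ρ⟩
  · exact (σ.exists_divisor_eq_and_le c ρ).imp fun _ => And.right

theorem toReal_mem_dualCone {m : Fin n → ℤ} : toReal m ∈ σ.dualCone ↔ 0 ≤ σ.divisor m := by
  rw [mem_dualCone, Pi.le_def]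
  refine forall_congr' fun ρ => ?_
  rw [toReal_dotProduct]
  exact Int.cast_nonneg_iff

end Divisors

end ToricCone

section Fractional

variable {R S : Type*} [CommRing R] [CommRing S] [Algebra R S]

theorem mul_map_eq_mul_map (hR : ∀ s : S, ∃ b : R, algebraMap R S b ∈ nonZeroDivisors S ∧
    b • s ∈ Set.range (algebraMap R S)) {N : Submodule R S} (φ : N →ₗ[R] S) (x y : N) :
    (x : S) * φ y = y * φ x := by
  obtain ⟨b, hb, a, ha⟩ := hR x
  obtain ⟨c, hc, d, hd⟩ := hR y
  have key : (c * a) • y = (b * d) • x := Subtype.ext <| by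
    simp only [Submodule.coe_smul, Algebra.smul_def, map_mul, ha, hd]
    ring
  have hφ := congrArg φ key
  simp only [map_smul, Algebra.smul_def, map_mul, ha, hd] at hφ
  rw [← mul_cancel_left_mem_nonZeroDivisors (mul_mem hb hc)]
  linear_combination hφ

theorem exists_map_eq_mul (hR : ∀ s : S, ∃ b : R, algebraMap R S b ∈ nonZeroDivisors S ∧
    b • s ∈ Set.range (algebraMap R S)) {N : Submodule R S} (hN : ∃ e ∈ N, IsUnit e)
    (φ : N →ₗ[R] S) : ∃ s : S, ∀ x, φ x = s * x := by
  obtain ⟨_, he, e, rfl⟩ := hN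
  refine ⟨↑e⁻¹ * φ ⟨e, he⟩, fun x => ?_⟩
  rw [mul_assoc, mul_comm _ (x : S), Units.eq_inv_mul_iff_mul_eq]
  exact mul_map_eq_mul_map hR φ ⟨e, he⟩ x

theorem nonempty_linearEquiv_iff_exists_units_mul_mem_iff (hR : ∀ s : S, ∃ b : R,
    algebraMap R S b ∈ nonZeroDivisors S ∧ b • s ∈ Set.range (algebraMap R S))
    {N N' : Submodule R S} (hN : ∃ e ∈ N, IsUnit e) (hN' : ∃ e ∈ N', IsUnit e) :
    Nonempty (N ≃ₗ[R] N') ↔ ∃ u : Sˣ, ∀ x : S, u * x ∈ N' ↔ x ∈ N := by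
  constructor
  · rintro ⟨φ⟩
    obtain ⟨s, hs⟩ := exists_map_eq_mul hR hN (N'.subtype ∘ₗ φ.toLinearMap)
    obtain ⟨t, ht⟩ := exists_map_eq_mul hR hN' (N.subtype ∘ₗ φ.symm.toLinearMap)
    have hs : ∀ x, (φ x : S) = s * x := hs
    have ht : ∀ y, (φ.symm y : S) = t * y := ht
    have hts : t * s = 1 := by
      obtain ⟨e, heN, he⟩ := hN
      have hφe := ht (φ ⟨e, heN⟩)
      rw [φ.symm_apply_apply, hs, ← mul_assoc] at hφe
      exact he.mul_eq_right.1 hφe.symm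
    refine ⟨⟨s, t, by rw [mul_comm, hts], hts⟩, fun x => ⟨fun hx => ?_, fun hx => ?_⟩⟩
    · have hmem := (φ.symm ⟨_, hx⟩).2
      rwa [ht, ← mul_assoc, hts, one_mul] at hmem
    · exact hs ⟨x, hx⟩ ▸ (φ ⟨x, hx⟩).2
  · rintro ⟨u, hu⟩
    obtain rfl : N = N'.comap (DistribMulAction.toLinearEquiv R S u).toLinearMap :=
      Submodule.ext fun x => (hu x).symm
    exact ⟨(DistribMulAction.toLinearEquiv R S u).ofSubmodule' N'⟩

end Fractional

theorem isUnit_single_one {k G : Type*} [Semiring k] [AddGroup G] (m : G) :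
    IsUnit (AddMonoidAlgebra.single m (1 : k)) :=
  (Group.isUnit (Multiplicative.ofAdd m)).map (AddMonoidAlgebra.of k G)

theorem exists_eq_single_of_mul_eq_single {k G : Type*} [Semiring k] [NoZeroDivisors k] [Add G]
    [TwoUniqueSums G] {f g : AddMonoidAlgebra k G} {m : G} {r : k} (hr : r ≠ 0)
    (h : f * g = .single m r) : ∃ (a : G) (s : k), s ≠ 0 ∧ f = .single a s := by
  classical
  have hfg : f ≠ 0 ∧ g ≠ 0 := ne_zero_and_ne_zero_of_mul (h ▸ by simpa using hr)
  have hf : 0 < f.coeff.support.card := by simpa [Finset.card_pos] using hfg.1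
  have hg : 0 < g.coeff.support.card := by simpa [Finset.card_pos] using hfg.2
  have hsum : ∀ p ∈ f.coeff.support ×ˢ g.coeff.support,
      UniqueAdd f.coeff.support g.coeff.support p.1 p.2 → p.1 + p.2 = m := by
    intro p hp hu
    by_contra hne
    have hcoeff := AddMonoidAlgebra.coeff_mul_add_of_uniqueAdd hu
    rw [h, AddMonoidAlgebra.coeff_single, Finsupp.single_eq_of_ne hne] at hcoeff
    rw [Finset.mem_product, Finsupp.mem_support_iff, Finsupp.mem_support_iff] at hp
    exact mul_ne_zero hp.1 hp.2 hcoeff.symm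
  have hcard : f.coeff.support.card = 1 := by
    by_contra hne
    obtain ⟨p, hp, q, hq, hpq, hup, huq⟩ := TwoUniqueSums.uniqueAdd_of_one_lt_card
      ((by omega : 1 < f.coeff.support.card).trans_le (Nat.le_mul_of_pos_right _ hg))
    rw [Finset.mem_product] at hp
    obtain ⟨h1, h2⟩ := huq hp.1 hp.2
      ((hsum p (Finset.mem_product.2 hp) hup).trans (hsum q hq huq).symm)
    exact hpq (Prod.ext h1 h2)
  obtain ⟨a, ha⟩ := Finset.card_eq_one.1 hcard
  obtain ⟨hne, hs⟩ := Finsupp.support_eq_singleton.1 ha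
  exact ⟨a, f.coeff a, hne, AddMonoidAlgebra.coeff_injective hs⟩

namespace ToricCone

section DivisorialModules

variable {n : ℕ} (σ : ToricCone n) (k : Type*) [Field k]

/-- The `R`-submodule of `k[M]` spanned by the monomials `x^m` with `⟨m, u_ρ⟩ ≥ c ρ` for all rays
`ρ`, i.e. the module of global sections of `𝒪(-∑_ρ c ρ • D_ρ)`. -/
noncomputable def divisorialModule (c : σ.rays → ℤ) :
    Submodule (σ.toricAlgebra k) (AddMonoidAlgebra k (Fin n → ℤ)) :=
  σ.monomialSpan k {m | c ≤ σ.divisor m} fun s t hs ht => by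
    change c ≤ σ.divisor (s + t)
    rw [divisor_add]
    exact le_add_of_nonneg_of_le (σ.toReal_mem_dualCone.1 hs) ht

variable {k}

theorem mem_divisorialModule {c : σ.rays → ℤ} {f : AddMonoidAlgebra k (Fin n → ℤ)} :
    f ∈ σ.divisorialModule k c ↔ ∀ m, f.coeff m ≠ 0 → c ≤ σ.divisor m := Iff.rfl

theorem mem_toricAlgebra_iff {f : AddMonoidAlgebra k (Fin n → ℤ)} :
    f ∈ σ.toricAlgebra k ↔ f ∈ σ.divisorialModule k 0 :=
  forall₂_congr fun _ _ => σ.toReal_mem_dualCone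

theorem single_mem_divisorialModule {c : σ.rays → ℤ} {m : Fin n → ℤ} {r : k} (hr : r ≠ 0) :
    .single m r ∈ σ.divisorialModule k c ↔ c ≤ σ.divisor m := by
  simp [mem_divisorialModule, Finsupp.single_apply, hr]

theorem single_mul_mem_divisorialModule {c : σ.rays → ℤ} {m : Fin n → ℤ} {r : k} (hr : r ≠ 0)
    {f : AddMonoidAlgebra k (Fin n → ℤ)} :
    .single m r * f ∈ σ.divisorialModule k (c + σ.divisor m) ↔ f ∈ σ.divisorialModule k c := by
  rw [mem_divisorialModule, mem_divisorialModule, ← (Equiv.addLeft m).forall_congr_right]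
  refine forall_congr' fun t => ?_
  rw [Equiv.coe_addLeft, AddMonoidAlgebra.coeff_single_mul_apply, neg_add_cancel_left,
    divisor_add, add_comm c, add_le_add_iff_left, mul_ne_zero_iff_left hr]

theorem divisorialModule_le_divisorialModule_iff {c c' : σ.rays → ℤ} :
    σ.divisorialModule k c ≤ σ.divisorialModule k c' ↔ c' ≤ c := by
  refine ⟨fun h ρ => ?_, fun h f hf m hm => h.trans (hf m hm)⟩
  obtain ⟨m, hmρ, hm⟩ := σ.exists_divisor_eq_and_le c ρ
  rw [← hmρ]
  exact (σ.single_mem_divisorialModule one_ne_zero).1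
    (h ((σ.single_mem_divisorialModule (one_ne_zero (α := k))).2 hm)) ρ

variable (k) in
theorem divisorialModule_injective : Function.Injective (σ.divisorialModule k) := fun _ _ h =>
  le_antisymm (σ.divisorialModule_le_divisorialModule_iff.1 h.ge)
    (σ.divisorialModule_le_divisorialModule_iff.1 h.le)

theorem exists_mem_divisorialModule_neg (f : AddMonoidAlgebra k (Fin n → ℤ)) :
    ∃ c, 0 ≤ c ∧ f ∈ σ.divisorialModule k (-c) := by
  refine ⟨fun ρ => ∑ m ∈ f.coeff.support, |σ.divisor m ρ|,
    fun ρ => Finset.sum_nonneg fun m _ => abs_nonneg _, fun m hm ρ => ?_⟩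
  refine (neg_le_neg ?_).trans (neg_abs_le (σ.divisor m ρ))
  exact Finset.single_le_sum (f := fun m => |σ.divisor m ρ|) (fun m _ => abs_nonneg _)
    (Finsupp.mem_support_iff.2 hm)

theorem exists_smul_mem_range_algebraMap (f : AddMonoidAlgebra k (Fin n → ℤ)) :
    ∃ b : σ.toricAlgebra k, algebraMap _ (AddMonoidAlgebra k (Fin n → ℤ)) b ∈ nonZeroDivisors _ ∧
      b • f ∈ Set.range (algebraMap (σ.toricAlgebra k) (AddMonoidAlgebra k (Fin n → ℤ))) := by
  obtain ⟨c, hc, hf⟩ := σ.exists_mem_divisorialModule_neg f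
  obtain ⟨m, hm⟩ := σ.exists_le_divisor c
  have hb : .single m (1 : k) ∈ σ.toricAlgebra k := σ.mem_toricAlgebra_iff.2
    ((σ.single_mem_divisorialModule one_ne_zero).2 (hc.trans hm))
  have hbf : .single m (1 : k) * f ∈ σ.toricAlgebra k := σ.mem_toricAlgebra_iff.2
    (σ.divisorialModule_le_divisorialModule_iff.2 (by rwa [le_neg_add_iff_add_le, add_zero])
      ((σ.single_mul_mem_divisorialModule one_ne_zero).2 hf))
  exact ⟨⟨_, hb⟩, (isUnit_single_one m).mem_nonZeroDivisors, ⟨_, hbf⟩, rfl⟩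

theorem exists_isUnit_mem_divisorialModule (c : σ.rays → ℤ) :
    ∃ e ∈ σ.divisorialModule k c, IsUnit e := by
  obtain ⟨m, hm⟩ := σ.exists_le_divisor c
  exact ⟨_, (σ.single_mem_divisorialModule one_ne_zero).2 hm, isUnit_single_one m⟩

variable (k) in
theorem nonempty_divisorialModule_linearEquiv_iff {c c' : σ.rays → ℤ} :
    Nonempty (σ.divisorialModule k c ≃ₗ[σ.toricAlgebra k] σ.divisorialModule k c') ↔
      σ.LinEquiv c' c := by
  rw [nonempty_linearEquiv_iff_exists_units_mul_mem_iff (N := σ.divisorialModule k c)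
    (N' := σ.divisorialModule k c') σ.exists_smul_mem_range_algebraMap
    (σ.exists_isUnit_mem_divisorialModule c) (σ.exists_isUnit_mem_divisorialModule c')]
  constructor
  · rintro ⟨u, hu⟩
    obtain ⟨m, r, hr, hm⟩ := exists_eq_single_of_mul_eq_single one_ne_zero
      (u.mul_inv.trans AddMonoidAlgebra.one_def)
    refine ⟨m, σ.divisorialModule_injective k (Submodule.ext fun f => ?_)⟩
    rw [← u.mul_inv_cancel_left f, hu, hm, σ.single_mul_mem_divisorialModule hr]
  · rintro ⟨m, rfl⟩
    obtain ⟨u, hu⟩ := isUnit_single_one (k := k) m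
    exact ⟨u, fun f => hu ▸ σ.single_mul_mem_divisorialModule one_ne_zero⟩

end DivisorialModules

end ToricCone

namespace ToricCone

section Rounding

variable {n : ℕ} (σ : ToricCone n)

/-- The set of rays `ρ` for which `⟨x, u_ρ⟩` is an integer. Together with `-d(x)` it determines the
open cell of `x`. -/
noncomputable def integralRays (x : Fin n → ℝ) : Finset σ.rays :=
  open Classical in
  Finset.univ.filter fun ρ => x ⬝ᵥ toReal ρ.1 ∈ Set.range ((↑) : ℤ → ℝ)

theorem negD_apply (x : Fin n → ℝ) (ρ : σ.rays) : σ.negD x ρ = -⌈x ⬝ᵥ toReal ρ.1⌉ := by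
  rw [negD, neg_dotProduct, Int.floor_neg]

theorem mem_integralRays {x : Fin n → ℝ} {ρ : σ.rays} :
    ρ ∈ σ.integralRays x ↔ x ⬝ᵥ toReal ρ.1 = -σ.negD x ρ := by
  simp only [integralRays, Finset.mem_filter_univ, ← Int.ceil_eq_self_iff_mem]
  rw [negD_apply, Int.cast_neg, neg_neg, eq_comm]

theorem negD_eq_iff {x : Fin n → ℝ} {D : σ.rays → ℤ} :
    σ.negD x = D ↔ ∀ ρ, x ⬝ᵥ toReal ρ.1 ∈ Set.Ioc (-D ρ - 1 : ℝ) (-D ρ) := by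
  refine funext_iff.trans (forall_congr' fun ρ => ?_)
  rw [negD_apply, neg_eq_iff_eq_neg, Int.ceil_eq_iff, Int.cast_neg, Set.mem_Ioc]

theorem negD_eq_and_integralRays_eq_iff {x : Fin n → ℝ} {D : σ.rays → ℤ} {J : Finset σ.rays} :
    σ.negD x = D ∧ σ.integralRays x = J ↔
      (∀ ρ ∈ J, x ⬝ᵥ toReal ρ.1 = -D ρ) ∧
        ∀ ρ ∉ J, x ⬝ᵥ toReal ρ.1 ∈ Set.Ioo (-D ρ - 1 : ℝ) (-D ρ) := by
  constructor
  · rintro ⟨rfl, rfl⟩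
    have hx := σ.negD_eq_iff.1 (rfl : σ.negD x = _)
    exact ⟨fun ρ => σ.mem_integralRays.1, fun ρ hρ =>
      ⟨(hx ρ).1, (hx ρ).2.lt_of_ne (σ.mem_integralRays.not.1 hρ)⟩⟩
  · rintro ⟨hJ, hJc⟩
    obtain rfl : σ.negD x = D := σ.negD_eq_iff.2 fun ρ => by
      by_cases hρ : ρ ∈ J
      · simp [hJ ρ hρ]
      · exact Set.Ioo_subset_Ioc_self (hJc ρ hρ)
    refine ⟨rfl, Finset.ext fun ρ => σ.mem_integralRays.trans ⟨fun h => ?_, hJ ρ⟩⟩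
    by_contra hρ
    exact (hJc ρ hρ).2.ne h

theorem sumD_apply (J : Finset σ.rays) (ρ : σ.rays) : σ.sumD J ρ = if ρ ∈ J then 1 else 0 := by
  simp [sumD, Finset.sum_apply, Pi.single_apply]

theorem sumD_injective : Function.Injective σ.sumD := fun I J h => Finset.ext fun ρ => by
  have hρ := congrFun h ρ
  rw [sumD_apply, sumD_apply] at hρ
  split_ifs at hρ <;> simp_all

theorem dotProduct_le_intCast_iff {x : Fin n → ℝ} {ρ : σ.rays} {z : ℤ} :
    x ⬝ᵥ toReal ρ.1 ≤ z ↔ (-σ.negD x) ρ ≤ z := by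
  rw [Pi.neg_apply, negD_apply, neg_neg, Int.ceil_le]

theorem dotProduct_lt_intCast_iff {x : Fin n → ℝ} {ρ : σ.rays} {z : ℤ} :
    x ⬝ᵥ toReal ρ.1 < z ↔ (-σ.negD x + σ.sumD (σ.integralRays x)) ρ ≤ z := by
  rw [Pi.add_apply, sumD_apply]
  split_ifs with h
  · rw [σ.mem_integralRays.1 h, ← Int.cast_neg, Int.cast_lt]
    exact Int.lt_iff_add_one_le
  · rw [add_zero, ← dotProduct_le_intCast_iff, lt_iff_le_and_ne, and_iff_left_iff_imp]
    rintro - hz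
    refine h (σ.mem_integralRays.2 ?_)
    rw [negD_apply, hz, Int.ceil_intCast, Int.cast_neg, neg_neg]

end Rounding

section Cells

variable {n : ℕ} (σ : ToricCone n) (k : Type*) [Field k]

theorem conicModule_eq_divisorialModule (v : Fin n → ℝ) :
    σ.conicModule k v = σ.divisorialModule k (-σ.negD v) := by
  have hmem (m : Fin n → ℤ) : toReal m - v ∈ σ.dualCone ↔ -σ.negD v ≤ σ.divisor m := by
    rw [mem_dualCone]
    refine forall_congr' fun ρ => ?_
    rw [sub_dotProduct, sub_nonneg, toReal_dotProduct, dotProduct_le_intCast_iff, divisor]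
  exact Submodule.ext fun f => forall₂_congr fun m _ => hmem m

theorem openConicModule_eq_divisorialModule (x : Fin n → ℝ) :
    σ.openConicModule k x = σ.divisorialModule k (-σ.negD x + σ.sumD (σ.integralRays x)) := by
  have hmem (m : Fin n → ℤ) : toReal m - x ∈ interior (σ.dualCone : Set (Fin n → ℝ)) ↔
      -σ.negD x + σ.sumD (σ.integralRays x) ≤ σ.divisor m := by
    rw [mem_interior_dualCone]
    refine forall_congr' fun ρ => ?_
    rw [sub_dotProduct, sub_pos, toReal_dotProduct, dotProduct_lt_intCast_iff, divisor]
  exact Submodule.ext fun f => forall₂_congr fun m _ => hmem m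

theorem mem_chamber_iff {v w : Fin n → ℝ} : w ∈ σ.chamber k v ↔ σ.negD w = σ.negD v := by
  rw [chamber, Set.mem_ofPred_eq, conicModule_eq_divisorialModule, conicModule_eq_divisorialModule,
    (σ.divisorialModule_injective k).eq_iff, neg_inj]

theorem mem_cell_iff {x y : Fin n → ℝ} :
    y ∈ σ.cell k x ↔ σ.negD y = σ.negD x ∧ σ.integralRays y = σ.integralRays x := by
  refine and_congr_right_iff.2 (fun h => ?_) |>.trans (and_congr_left' (σ.mem_chamber_iff k))
  rw [openConicModule_eq_divisorialModule, openConicModule_eq_divisorialModule,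
    (σ.divisorialModule_injective k).eq_iff, (σ.mem_chamber_iff k).1 h, add_right_inj,
    σ.sumD_injective.eq_iff]

/-- The matrix `A_J` with rows `u_ρ`, `ρ ∈ J`, whose rank is `pathLength J`. -/
def rayMatrix (J : Finset σ.rays) : Matrix J (Fin n) ℝ :=
  Matrix.of fun ρ => toReal ρ.1.1

theorem mem_ker_rayMatrix {J : Finset σ.rays} {x : Fin n → ℝ} :
    x ∈ LinearMap.ker (σ.rayMatrix J).mulVecLin ↔ ∀ ρ ∈ J, x ⬝ᵥ toReal ρ.1 = 0 := by
  rw [LinearMap.mem_ker, Matrix.mulVecLin_apply, funext_iff, Subtype.forall]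
  refine forall₂_congr fun ρ hρ => ?_
  rw [dotProduct_comm]
  rfl

theorem cell_eq_inter (x : Fin n → ℝ) : σ.cell k x =
    (AffineSubspace.mk' x (LinearMap.ker (σ.rayMatrix (σ.integralRays x)).mulVecLin) : Set _) ∩
      {y | ∀ ρ ∉ σ.integralRays x,
        y ⬝ᵥ toReal ρ.1 ∈ Set.Ioo (-σ.negD x ρ - 1 : ℝ) (-σ.negD x ρ)} := by
  ext y
  rw [mem_cell_iff, negD_eq_and_integralRays_eq_iff]
  refine and_congr_left' ?_
  rw [SetLike.mem_coe, AffineSubspace.mem_mk', mem_ker_rayMatrix]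
  refine forall₂_congr fun ρ hρ => ?_
  rw [vsub_eq_sub, sub_dotProduct, sub_eq_zero, σ.mem_integralRays.1 hρ]

theorem vectorSpan_cell (x : Fin n → ℝ) : vectorSpan ℝ (σ.cell k x) =
    LinearMap.ker (σ.rayMatrix (σ.integralRays x)).mulVecLin := by
  have hopen : IsOpen {y : Fin n → ℝ | ∀ ρ ∉ σ.integralRays x,
      y ⬝ᵥ toReal ρ.1 ∈ Set.Ioo (-σ.negD x ρ - 1 : ℝ) (-σ.negD x ρ)} := by
    simp only [Set.ofPred_forall]
    exact isOpen_iInter_of_finite fun ρ => isOpen_iInter_of_finite fun _ =>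
      isOpen_Ioo.preimage (by unfold dotProduct; fun_prop)
  have hx : x ∈ σ.cell k x := ⟨rfl, rfl⟩
  rw [cell_eq_inter] at hx ⊢
  rw [vectorSpan_inter_of_isOpen hopen ⟨x, hx⟩, AffineSubspace.direction_mk']

theorem finrank_vectorSpan_cell_add_pathLength (x : Fin n → ℝ) :
    Module.finrank ℝ (vectorSpan ℝ (σ.cell k x)) + σ.pathLength (σ.integralRays x) = n := by
  rw [vectorSpan_cell, add_comm]
  exact (LinearMap.finrank_range_add_finrank_ker _).trans (Module.finrank_fin_fun ℝ)

theorem cell_mem_cellsOfCodim_iff {v x : Fin n → ℝ} {l : ℕ} (hx : x ∈ σ.chamber k v) :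
    σ.cell k x ∈ σ.cellsOfCodim k v l ↔ l = σ.pathLength (σ.integralRays x) := by
  have hcodim := σ.finrank_vectorSpan_cell_add_pathLength k x
  constructor
  · rintro ⟨_, -, -, hl⟩
    omega
  · rintro rfl
    exact ⟨x, hx, rfl, hcodim⟩

theorem nonempty_conicModule_linearEquiv_cellModule_iff {w x : Fin n → ℝ} :
    Nonempty (σ.conicModule k w ≃ₗ[σ.toricAlgebra k] σ.cellModule k (σ.cell k x)) ↔
      σ.LinEquiv (σ.negD w) (σ.negD x - σ.sumD (σ.integralRays x)) := by
  rw [cellModule_cell, conicModule_eq_divisorialModule, openConicModule_eq_divisorialModule,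
    nonempty_divisorialModule_linearEquiv_iff]
  refine exists_congr fun m => ?_
  constructor <;> intro h <;> linear_combination h

theorem appearsInDegree_iff {w v : Fin n → ℝ} {l : ℕ} : σ.AppearsInDegree k w v l ↔
    ∃ x, σ.negD x = σ.negD v ∧ l = σ.pathLength (σ.integralRays x) ∧
      σ.LinEquiv (σ.negD w) (σ.negD v - σ.sumD (σ.integralRays x)) := by
  constructor
  · rintro ⟨⟨_, hτ⟩, hiso⟩
    obtain ⟨x, hx, rfl, -⟩ := id hτ
    have hxv := (σ.mem_chamber_iff k).1 hx
    exact ⟨x, hxv, (σ.cell_mem_cellsOfCodim_iff k hx).1 hτ,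
      hxv ▸ (σ.nonempty_conicModule_linearEquiv_cellModule_iff k).1 hiso⟩
  · rintro ⟨x, hxv, hl, hw⟩
    exact ⟨⟨_, (σ.cell_mem_cellsOfCodim_iff k ((σ.mem_chamber_iff k).2 hxv)).2 hl⟩,
      (σ.nonempty_conicModule_linearEquiv_cellModule_iff k).2 (hxv ▸ hw)⟩

end Cells

end ToricCone

namespace ToricCone

section ClassGroup

variable {n : ℕ} (σ : ToricCone n)

theorem divisorReal_apply (x : Fin n → ℝ) (ρ : σ.rays) :
    σ.divisorReal x ρ = x ⬝ᵥ toReal ρ.1 := rfl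

theorem fσ_eq_iff {a b : σ.rays → ℝ} : σ.fσ a = σ.fσ b ↔ ∃ x, b = a + σ.divisorReal x := by
  rw [eq_comm, fσ, Submodule.mkQ_apply, Submodule.mkQ_apply, Submodule.Quotient.eq,
    LinearMap.mem_range]
  exact exists_congr fun x => by rw [eq_comm, sub_eq_iff_eq_add']

theorem fσ_indicator (J : Finset σ.rays) (a : σ.rays → ℝ) :
    σ.fσ ((J : Set σ.rays).indicator a) = ∑ ρ ∈ J, a ρ • σ.β ρ := by
  rw [pi_eq_sum_univ' ((J : Set σ.rays).indicator a), map_sum, ← Finset.sum_subset J.subset_univ]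
  · exact Finset.sum_congr rfl fun ρ hρ => by rw [Set.indicator_of_mem hρ, map_smul, β]
  · exact fun ρ _ hρ => by rw [Set.indicator_of_notMem hρ, zero_smul, map_zero]

theorem fσ_eq_sum (a : σ.rays → ℝ) : σ.fσ a = ∑ ρ, a ρ • σ.β ρ := by
  rw [← fσ_indicator, Finset.coe_univ, Set.indicator_univ]

theorem fInt_add (D E : σ.rays → ℤ) : σ.fInt (D + E) = σ.fInt D + σ.fInt E := by
  simp only [fInt, ← map_add, Pi.add_apply, Int.cast_add]
  rfl

theorem fInt_sumD (J : Finset σ.rays) : σ.fInt (σ.sumD J) = ∑ ρ ∈ J, σ.β ρ := by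
  rw [fInt, fσ_eq_sum]
  simp [sumD_apply]

theorem fInt_sub_sumD (D : σ.rays → ℤ) (J : Finset σ.rays) :
    σ.fInt (D - σ.sumD J) = σ.fInt D - ∑ ρ ∈ J, σ.β ρ := by
  rw [eq_sub_iff_add_eq, ← fInt_sumD, ← fInt_add, sub_add_cancel]

variable {σ} in
theorem LinEquiv.refl (D : σ.rays → ℤ) : σ.LinEquiv D D :=
  ⟨0, funext fun ρ => by simp [divisor]⟩

variable {σ} in
theorem LinEquiv.fInt_eq {D E : σ.rays → ℤ} (h : σ.LinEquiv D E) : σ.fInt D = σ.fInt E := by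
  obtain ⟨m, rfl⟩ := h
  refine (σ.fσ_eq_iff.2 ⟨toReal m, funext fun ρ => ?_⟩).symm
  simp [divisorReal_apply, toReal_dotProduct, divisor]

theorem fInt_mem_zonotope_iff {D : σ.rays → ℤ} : σ.fInt D ∈ σ.zonotope ↔ ∃ w, σ.negD w = D := by
  have hmem (w : Fin n → ℝ) : σ.negD w = D ↔
      ∀ ρ, ((fun ρ => (D ρ : ℝ)) + σ.divisorReal w) ρ ∈ Set.Ioc (-1 : ℝ) 0 := by
    refine σ.negD_eq_iff.trans (forall_congr' fun ρ => ?_)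
    simp only [Pi.add_apply, divisorReal_apply, Set.mem_Ioc]
    constructor <;> intro h <;> constructor <;> linarith [h.1, h.2]
  simp only [hmem]
  constructor
  · rintro ⟨a, ha, h⟩
    obtain ⟨w, rfl⟩ := σ.fσ_eq_iff.1 h.symm
    exact ⟨w, ha⟩
  · rintro ⟨w, hw⟩
    exact ⟨_, hw, (σ.fσ_eq_iff.2 ⟨w, rfl⟩).symm⟩

theorem fInt_negD_mem_latticePoints (w : Fin n → ℝ) : σ.fInt (σ.negD w) ∈ σ.latticePoints :=
  ⟨σ.fInt_mem_zonotope_iff.2 ⟨w, rfl⟩, _, rfl⟩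

end ClassGroup

section Paths

variable {n : ℕ} (σ : ToricCone n)

theorem negD_eq_and_integralRays_eq_iff_exists_indicator {x : Fin n → ℝ} {D : σ.rays → ℤ}
    {J : Finset σ.rays} : σ.negD x = D ∧ σ.integralRays x = J ↔
      ∃ t : σ.rays → ℝ, (∀ ρ, t ρ ∈ Set.Ioo (0 : ℝ) 1) ∧
        -((Jᶜ : Finset σ.rays) : Set σ.rays).indicator t =
          (fun ρ => (D ρ : ℝ)) + σ.divisorReal x := by
  rw [negD_eq_and_integralRays_eq_iff]
  simp only [funext_iff, Pi.neg_apply, Pi.add_apply, divisorReal_apply,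
    Set.indicator_apply, Finset.mem_coe, Finset.mem_compl]
  constructor
  · rintro ⟨hJ, hJc⟩
    refine ⟨fun ρ => if ρ ∈ J then 1 / 2 else -D ρ - x ⬝ᵥ toReal ρ.1, fun ρ => ?_, fun ρ => ?_⟩
    · dsimp only
      split_ifs with hρ
      · norm_num
      · constructor <;> linarith [(hJc ρ hρ).1, (hJc ρ hρ).2]
    · by_cases hρ : ρ ∈ J
      · simp [hρ, hJ ρ hρ]
      · simp only [hρ, not_false_eq_true, if_true, if_false]
        ring
  · rintro ⟨t, ht, hD⟩
    refine ⟨fun ρ hρ => ?_, fun ρ hρ => ?_⟩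
    · have hDρ := hD ρ
      rw [if_neg (not_not.2 hρ)] at hDρ
      linarith
    · have hDρ := hD ρ
      rw [if_pos hρ] at hDρ
      constructor <;> linarith [(ht ρ).1, (ht ρ).2]

theorem validityCondition_iff_exists {J : Finset σ.rays} {D : σ.rays → ℤ} {α : σ.rays → ℚ}
    (hα : σ.fInt D = ∑ ρ, (α ρ : ℝ) • σ.β ρ) :
    σ.ValidityCondition J α ↔ ∃ x, σ.negD x = D ∧ σ.integralRays x = J := by
  simp only [negD_eq_and_integralRays_eq_iff_exists_indicator, validityCondition_iff, ← hα,
    ← fσ_indicator, ← map_neg, fInt, fσ_eq_iff]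
  rw [exists_comm]
  simp only [exists_and_left]

theorem isValidPath_fInt_negD_iff {J : Finset σ.rays} {P : σ.ClReal} {v : Fin n → ℝ} :
    σ.IsValidPath J P (σ.fInt (σ.negD v)) ↔ P ∈ σ.latticePoints ∧
      P = σ.fInt (σ.negD v - σ.sumD J) ∧ ∃ x, σ.negD x = σ.negD v ∧ σ.integralRays x = J := by
  rw [fInt_sub_sumD, eq_sub_iff_add_eq]
  constructor
  · rintro ⟨⟨hP, -, hPJ⟩, α, hα, hval⟩
    exact ⟨hP, hPJ, (σ.validityCondition_iff_exists hα).1 hval⟩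
  · rintro ⟨hP, hPJ, hx⟩
    have hα : σ.fInt (σ.negD v) = ∑ ρ, (((σ.negD v ρ : ℤ) : ℚ) : ℝ) • σ.β ρ := by
      simp only [fInt, fσ_eq_sum, Rat.cast_intCast]
    exact ⟨⟨hP, σ.fInt_negD_mem_latticePoints v, hPJ⟩, _, hα,
      (σ.validityCondition_iff_exists hα).2 hx⟩

variable {σ}

theorem IsValidPath.exists_linEquiv {J : Finset σ.rays} {P : σ.ClReal} {v : Fin n → ℝ}
    (h : σ.IsValidPath J P (σ.fInt (σ.negD v))) :
    ∃ w, σ.LinEquiv (σ.negD w) (σ.negD v - σ.sumD J) := by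
  obtain ⟨hP, rfl, -⟩ := σ.isValidPath_fInt_negD_iff.1 h
  obtain ⟨w, hw⟩ := σ.fInt_mem_zonotope_iff.1 hP.1
  exact ⟨w, hw ▸ .refl _⟩

theorem IsValidPath.eq_fInt_negD {J : Finset σ.rays} {P : σ.ClReal} {v w : Fin n → ℝ}
    (h : σ.IsValidPath J P (σ.fInt (σ.negD v)))
    (hw : σ.LinEquiv (σ.negD w) (σ.negD v - σ.sumD J)) : P = σ.fInt (σ.negD w) :=
  (σ.isValidPath_fInt_negD_iff.1 h).2.1.trans hw.fInt_eq.symm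

theorem IsValidPath.appearsInDegree (k : Type*) [Field k] {J : Finset σ.rays} {P : σ.ClReal}
    {v w : Fin n → ℝ} (h : σ.IsValidPath J P (σ.fInt (σ.negD v)))
    (hw : σ.LinEquiv (σ.negD w) (σ.negD v - σ.sumD J)) :
    σ.AppearsInDegree k w v (σ.pathLength J) := by
  obtain ⟨-, -, x, hx, rfl⟩ := σ.isValidPath_fInt_negD_iff.1 h
  exact (σ.appearsInDegree_iff k).2 ⟨x, hx, rfl, hw⟩

theorem AppearsInDegree.exists_isValidPath {k : Type*} [Field k] {v w : Fin n → ℝ} {l : ℕ}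
    (h : σ.AppearsInDegree k w v l) :
    ∃ J : Finset σ.rays, σ.IsValidPath J (σ.fInt (σ.negD w)) (σ.fInt (σ.negD v)) ∧
      σ.LinEquiv (σ.negD w) (σ.negD v - σ.sumD J) ∧ l = σ.pathLength J := by
  obtain ⟨x, hx, hl, hw⟩ := (σ.appearsInDegree_iff k).1 h
  exact ⟨σ.integralRays x, σ.isValidPath_fInt_negD_iff.2
    ⟨σ.fInt_negD_mem_latticePoints w, hw.fInt_eq, x, hx, rfl⟩, hw, hl⟩

end Paths

end ToricCone

theorem mainTheorem4 {n : ℕ} (k : Type*) [Field k] (σ : ToricCone n) (v : Fin n → ℝ) :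
    (∀ P₁ : σ.ClReal,
      (∃ J : Finset σ.rays, σ.IsValidPath J P₁ (σ.fInt (σ.negD v))) ↔
        ∃ w : Fin n → ℝ, σ.Appears k w v ∧ P₁ = σ.fInt (σ.negD w)) ∧
    (∀ (P₁ : σ.ClReal) (J : Finset σ.rays), σ.IsValidPath J P₁ (σ.fInt (σ.negD v)) →
      (∃ w : Fin n → ℝ, σ.LinEquiv (σ.negD w) (σ.negD v - σ.sumD J)) ∧
      ∀ w : Fin n → ℝ, σ.LinEquiv (σ.negD w) (σ.negD v - σ.sumD J) →
        P₁ = σ.fInt (σ.negD w) ∧ σ.AppearsInDegree k w v (σ.pathLength J)) ∧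
    (∀ (w : Fin n → ℝ) (l : ℕ), σ.AppearsInDegree k w v l →
      ∃ J : Finset σ.rays, σ.IsValidPath J (σ.fInt (σ.negD w)) (σ.fInt (σ.negD v)) ∧
        σ.LinEquiv (σ.negD w) (σ.negD v - σ.sumD J) ∧ l = σ.pathLength J) := by
  refine ⟨fun P => ⟨?_, ?_⟩, fun P J hJ => ⟨hJ.exists_linEquiv, fun w hw =>
    ⟨hJ.eq_fInt_negD hw, hJ.appearsInDegree k hw⟩⟩, fun w l h => h.exists_isValidPath⟩
  · rintro ⟨J, hJ⟩
    obtain ⟨w, hw⟩ := hJ.exists_linEquiv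
    exact ⟨w, ⟨_, hJ.appearsInDegree k hw⟩, hJ.eq_fInt_negD hw⟩
  · rintro ⟨w, ⟨l, h⟩, rfl⟩
    obtain ⟨J, hJ, -⟩ := h.exists_isValidPath
    exact ⟨J, hJ⟩
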